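/- A substitution $\eta$ on a finite alphabet $A$ assigns to each letter a nonempty finite word over $A$, and acts on words by concatenation; it is primitive if for some $k\ge 1$ every letter occurs in $\eta^k(a)$ for every letter $a$. Its language consists of all factors of the words $\eta^n(a)$ ($n\ge 0$, $a\in A$), and $X_\eta\subset A^{\mathbb Z}$ is the set of two-sided sequences all of whose finite subwords belong to the language, with the (product) topology and the shift $(\sigma x)_n=x_{n+1}$. Systems $(X_\alpha,\sigma)$ and $(X_\eta,\sigma)$ are topologically isomorphic if there is a homeomorphism $\psi:X_\alpha\to X_\eta$ with $\psi\sigma=\sigma\psi$. The Fibonacci system is $(X_\varphi,\sigma)$ with $\varphi: 0\mapsto 01,\ 1\mapsto 0$. A pair of letters $(b,a)$ is a cyclic pair of $\eta$ if $ba$ is in the language of $\eta$ and for some integer $m\ge 1$ the word $\eta^m(b)$ ends with $b$ and the word $\eta^m(a)$ begins with $a$. For primitive $\eta$ with more than one letter, such a pair generates the two-sided sequence $\eta^\infty(b)\cdot\eta^\infty(a)$, that is, the sequence $x$ in which, for every $k\ge 0$, the word $\eta^{mk}(b)$ ends at coordinate $-1$ and the word $\eta^{mk}(a)$ begins at coordinate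 $0$. A $Z$-triple in $X_\eta$ consists of three distinct points $x,y,z\in X_\eta$ generated by cyclic pairs of the form $(b,a)$, $(b,d)$ and $(c,d)$, respectively, with $a,b,c,d\in A$. **Theorem.** Let $\eta$ be a primitive substitution such that $(X_\eta,\sigma)$ is topologically isomorphic to the Fibonacci system $(X_\varphi,\sigma)$. Then there are no $Z$-triples in $X_\eta$. -/

import Mathlib

/-- A substitution on the alphabet `A`: every letter is sent to a nonempty finite word. -/
structure Substitution (A : Type*) where
  /-- the image of a letter -/
  image : A → List A
  image_ne_nil : ∀ a, image a ≠ []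

/-- The left shift `(σ x)ₙ = xₙ₊₁` on two-sided sequences. -/
def shift {A : Type*} (x : ℤ → A) : ℤ → A := fun n => x (n + 1)

/-- The word `x_i x_{i+1} … x_{i+n-1}`. -/
def subword {A : Type*} (x : ℤ → A) (i : ℤ) (n : ℕ) : List A :=
  (List.range n).map fun j => x (i + j)

namespace Substitution

variable {A : Type*}

/-- The substitution acting on words by concatenation. -/
def onWord (η : Substitution A) (w : List A) : List A := w.flatMap η.image

/-- `η.iter n w` is the word `ηⁿ(w)`. -/
def iter (η : Substitution A) (n : ℕ) (w : List A) : List A := η.onWord^[n] w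

/-- Some power of `η` maps every letter to a word in which all letters occur. -/
def IsPrimitive (η : Substitution A) : Prop :=
  ∃ k : ℕ, 0 < k ∧ ∀ a b : A, b ∈ η.iter k [a]

/-- The language of `η`: all factors of the words `ηⁿ(a)`. -/
def language (η : Substitution A) : Set (List A) :=
  {w | ∃ (n : ℕ) (a : A), w <:+: η.iter n [a]}

/-- `X_η`: the two-sided sequences all of whose finite subwords are in the language of `η`. -/
def space (η : Substitution A) : Set (ℤ → A) :=
  {x | ∀ (i : ℤ) (n : ℕ), subword x i n ∈ η.language}

theorem shift_mem_space (η : Substitution A) {x : ℤ → A} (hx : x ∈ η.space) :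
    shift x ∈ η.space := by
  intro i n
  have h : subword (shift x) i n = subword x (i + 1) n := by
    simp only [subword, shift]
    congr 1
    funext j
    congr 1
    ring
  rw [h]
  exact hx (i + 1) n

/-- The shift map of the dynamical system `(X_η, σ)`. -/
def shiftMap (η : Substitution A) (x : η.space) : η.space :=
  ⟨shift x.1, η.shift_mem_space x.2⟩

/-- The systems `(X_α, σ)` and `(X_η, σ)` are topologically isomorphic. Each space carries the
topology induced by the product topology on two-sided sequences. -/
def TopologicallyIsomorphic {B : Type*} [TopologicalSpace A] [TopologicalSpace B]
    (α : Substitution A) (η : Substitution B) : Prop :=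
  ∃ ψ : α.space ≃ₜ η.space, ∀ x, ψ (α.shiftMap x) = η.shiftMap (ψ x)

/-- `ba` is in the language of `η`, the word `η^m(b)` ends with `b` and the word `η^m(a)` begins
with `a`, where `m ≥ 1`. -/
def IsCyclicPairOfPeriod (η : Substitution A) (m : ℕ) (b a : A) : Prop :=
  0 < m ∧ [b, a] ∈ η.language ∧ [b] <:+ η.iter m [b] ∧ [a] <+: η.iter m [a]

/-- `(b, a)` is a cyclic pair of `η`. -/
def IsCyclicPair (η : Substitution A) (b a : A) : Prop :=
  ∃ m : ℕ, η.IsCyclicPairOfPeriod m b a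

/-- `x` is the point `η^∞(b)·η^∞(a)` generated by the cyclic pair `(b, a)`: for all `k`, the word
`η^(mk)(b)` stands in `x` directly to the left of coordinate `0`, and `η^(mk)(a)` directly follows
it, beginning at coordinate `0`. -/
def IsGeneratedBy (η : Substitution A) (b a : A) (x : ℤ → A) : Prop :=
  ∃ m : ℕ, η.IsCyclicPairOfPeriod m b a ∧ ∀ k : ℕ,
    subword x (-((η.iter (m * k) [b]).length : ℤ)) (η.iter (m * k) [b, a]).length =
      η.iter (m * k) [b, a]

/-- Three distinct points of `X_η` generated by cyclic pairs `(b, a)`, `(b, d)`, `(c, d)`. -/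
def IsZTriple (η : Substitution A) (x y z : η.space) : Prop :=
  x ≠ y ∧ y ≠ z ∧ x ≠ z ∧
    ∃ a b c d : A, η.IsGeneratedBy b a x.1 ∧ η.IsGeneratedBy b d y.1 ∧ η.IsGeneratedBy c d z.1

/-- The Fibonacci substitution `0 ↦ 01`, `1 ↦ 0`. -/
def fibonacci : Substitution (Fin 2) where
  image a := if a = 0 then [0, 1] else [0]
  image_ne_nil a := by split <;> simp

end Substitution

/-! In the Fibonacci system, two distinct points that agree far to the left differ at exactly two
adjacent coordinates, where one reads 01 and the other 10. The language is closed under reversal, so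
the same holds for points that agree far to the right.

In a Z-triple, `x`, `y` share their left half and `y`, `z` their right half. The inverse isomorphism
is a sliding block code, so the images `u`, `v`, `w` are asymptotic in the same way. Over two
letters, `u` and `w` differ exactly where one of the pairs `u, v` and `v, w` differs and the other
does not. The symmetric difference of two adjacent pairs is empty, or has four elements, or has two
elements at distance two; it is never an adjacent pair. But `u` and `w` are also left asymptotic, so
`u = w` and `x = z`.

The two-coordinate claim rests on `eq_of_mem_fibonacci_language`, proved by desubstitution. -/

namespace Substitution

/-! ### Words, language and growth -/

section Words

variable {A : Type*} (η : Substitution A)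

theorem onWord_append (v w : List A) : η.onWord (v ++ w) = η.onWord v ++ η.onWord w := by
  simp [onWord]

theorem iter_succ (n : ℕ) (w : List A) : η.iter (n + 1) w = η.onWord (η.iter n w) :=
  Function.iterate_succ_apply' _ _ _

theorem iter_add (m n : ℕ) (w : List A) : η.iter (m + n) w = η.iter m (η.iter n w) :=
  Function.iterate_add_apply _ _ _ _

theorem iter_append (n : ℕ) (v w : List A) :
    η.iter n (v ++ w) = η.iter n v ++ η.iter n w := by
  induction n with
  | zero => rfl
  | succ n ih => rw [iter_succ, ih, onWord_append, ← iter_succ, ← iter_succ]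

theorem length_le_length_onWord (w : List A) : w.length ≤ (η.onWord w).length := by
  induction w with
  | nil => simp
  | cons a w ih =>
    have h : 0 < (η.image a).length := List.length_pos_iff.2 (η.image_ne_nil a)
    have e : η.onWord (a :: w) = η.image a ++ η.onWord w := by simp [onWord]
    rw [e]
    simp only [List.length_cons, List.length_append]
    omega

theorem length_iter_mono (w : List A) : Monotone fun n => (η.iter n w).length :=
  monotone_nat_of_le_succ fun n => by
    rw [iter_succ]
    exact η.length_le_length_onWord _

variable {η}

theorem language_of_infix {v w : List A} (hw : w ∈ η.language) (h : v <:+: w) :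
    v ∈ η.language := by
  obtain ⟨n, a, hn⟩ := hw
  exact ⟨n, a, h.trans hn⟩

theorem onWord_mem_language {w : List A} (hw : w ∈ η.language) : η.onWord w ∈ η.language := by
  obtain ⟨n, a, s, t, h⟩ := hw
  refine ⟨n + 1, a, η.onWord s, η.onWord t, ?_⟩
  rw [iter_succ, ← h, onWord_append, onWord_append]

theorem iter_mem_language {w : List A} (hw : w ∈ η.language) (n : ℕ) :
    η.iter n w ∈ η.language := by
  induction n with
  | zero => exact hw
  | succ n ih => rw [iter_succ]; exact onWord_mem_language ih

theorem IsPrimitive.exists_le_length_iter [Nontrivial A] (hη : η.IsPrimitive) (N : ℕ) :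
    ∃ n, ∀ m, n ≤ m → ∀ b, N ≤ (η.iter m [b]).length := by
  obtain ⟨k, -, hk⟩ := hη
  -- The word contains every letter, and there are at least two.
  have two : ∀ a, 2 ≤ (η.iter k [a]).length := by
    intro a
    by_contra! h
    obtain ⟨c, d, hcd⟩ := exists_pair_ne A
    have hc := hk a c
    have hd := hk a d
    generalize η.iter k [a] = w at hc hd h
    match w, h with
    | [], _ => simp at hc
    | [e], _ => simp_all
  have double : ∀ w, 2 * w.length ≤ (η.iter k w).length := by
    intro w
    induction w with
    | nil => simp
    | cons a w ih =>
      have := two a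
      rw [← List.singleton_append, iter_append]
      simp only [List.length_append, List.length_singleton]
      omega
  have pow : ∀ n b, 2 ^ n ≤ (η.iter (k * n) [b]).length := by
    intro n b
    induction n with
    | zero => simp [iter]
    | succ n ih =>
      have := double (η.iter (k * n) [b])
      rw [← iter_add] at this
      rw [Nat.mul_succ, add_comm (k * n), pow_succ]
      omega
  exact ⟨k * N, fun m hm b => (Nat.lt_two_pow_self.le.trans (pow N b)).trans
    (η.length_iter_mono [b] hm)⟩

end Words

/-! ### Subwords, the shift and sliding block codes -/

section Sequences

variable {A : Type*} {η : Substitution A}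

/-- The body of `subword` first coerces the range to a list of integers; here the index is natural.
-/
theorem subword_eq_map (x : ℤ → A) (i : ℤ) (n : ℕ) :
    subword x i n = (List.range n).map fun j : ℕ => x (i + j) := by
  have h (l : List ℕ) :
      (l.flatMap fun a : ℕ => [(a : ℤ)]) = l.map fun a : ℕ => (a : ℤ) :=
    List.flatMap_pure_eq_map _ l
  unfold subword
  refine (congrArg (List.map fun j : ℤ => x (i + j)) (h (List.range n))).trans ?_
  simp [Function.comp_def]

theorem length_subword (x : ℤ → A) (i : ℤ) (n : ℕ) : (subword x i n).length = n := by
  simp [subword_eq_map]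

theorem getElem_subword (x : ℤ → A) (i : ℤ) (n j : ℕ) (h : j < (subword x i n).length) :
    (subword x i n)[j] = x (i + j) := by
  simp [subword_eq_map]

theorem subword_add (x : ℤ → A) (i : ℤ) (m n : ℕ) :
    subword x i (m + n) = subword x i m ++ subword x (i + m) n := by
  simp [subword_eq_map, List.range_add, add_assoc]

theorem subword_succ (x : ℤ → A) (i : ℤ) (n : ℕ) :
    subword x i (n + 1) = subword x i n ++ [x (i + n)] := by
  simp [subword_eq_map, List.range_succ]

theorem subword_congr {x y : ℤ → A} {i : ℤ} {n : ℕ}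
    (h : ∀ j, i ≤ j → j < i + n → x j = y j) : subword x i n = subword y i n := by
  simp only [subword_eq_map]
  refine List.map_congr_left fun j hj => h _ (by omega) ?_
  have := List.mem_range.1 hj
  omega

theorem subword_translate (x : ℤ → A) (k i : ℤ) (n : ℕ) :
    subword (fun j => x (j + k)) i n = subword x (i + k) n := by
  simp only [subword_eq_map]
  refine List.map_congr_left fun j _ => ?_
  congr 1
  ring

theorem translate_mem_space {x : ℤ → A} (hx : x ∈ η.space) (k : ℤ) :
    (fun j => x (j + k)) ∈ η.space := by
  intro i n
  rw [subword_translate]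
  exact hx _ _

/-- The `k`-th power of the shift of `X_η`. -/
def translate (k : ℤ) (x : η.space) : η.space := ⟨_, translate_mem_space x.2 k⟩

theorem translate_apply (k : ℤ) (x : η.space) (j : ℤ) : (translate k x).1 j = x.1 (j + k) := rfl

theorem subword_reverse (x : ℤ → A) (i : ℤ) (n : ℕ) :
    subword (fun j => x (-j)) i n = (subword x (1 - i - n) n).reverse := by
  refine List.ext_getElem (by simp [length_subword]) fun j h₁ h₂ => ?_
  rw [length_subword] at h₁
  rw [List.getElem_reverse, getElem_subword, getElem_subword, length_subword]
  congr 1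
  omega

theorem isClosed_space [TopologicalSpace A] [DiscreteTopology A] : IsClosed η.space := by
  have h : η.space = ⋂ (i : ℤ) (n : ℕ), {x | subword x i n ∈ η.language} := by
    ext x
    simp [space]
  rw [h]
  refine isClosed_iInter fun i => isClosed_iInter fun n => ?_
  have e : {x : ℤ → A | subword x i n ∈ η.language} =
      (fun (x : ℤ → A) (j : Fin n) => x (i + (j : ℕ))) ⁻¹' {f | List.ofFn f ∈ η.language} := by
    ext x
    have : subword x i n = List.ofFn fun j : Fin n => x (i + (j : ℕ)) :=
      List.ext_getElem (by simp [length_subword]) fun j h₁ h₂ => by simp [getElem_subword]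
    simp [this]
  rw [e]
  exact (isClosed_discrete _).preimage (by fun_prop)

/-- By compactness: the closed sets `U N` decrease to the diagonal, so one of them lies in the open
set `V` containing it. -/
theorem exists_window [Finite A] [TopologicalSpace A] [DiscreteTopology A] {C : Type*}
    [TopologicalSpace C] [DiscreteTopology C] {f : η.space → C} (hf : Continuous f) :
    ∃ N : ℤ, ∀ x y : η.space, (∀ n, -N ≤ n → n ≤ N → x.1 n = y.1 n) → f x = f y := by
  have : CompactSpace η.space := isCompact_iff_compactSpace.1 isClosed_space.isCompact
  let U : ℕ → Set (η.space × η.space) := fun N =>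
    {q | ∀ n : ℤ, -(N : ℤ) ≤ n → n ≤ N → q.1.1 n = q.2.1 n}
  have hU : ∀ N, IsClosed (U N) := by
    intro N
    simp only [U, Set.ofPred_forall]
    refine isClosed_iInter fun n => isClosed_iInter fun _ => isClosed_iInter fun _ => ?_
    exact isClosed_eq ((continuous_apply n).comp (continuous_subtype_val.comp continuous_fst))
      ((continuous_apply n).comp (continuous_subtype_val.comp continuous_snd))
  let V : Set (η.space × η.space) := {q | f q.1 = f q.2}
  have hV : IsOpen V := by
    have : V = (fun q : η.space × η.space => (f q.1, f q.2)) ⁻¹' {p | p.1 = p.2} := rfl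
    rw [this]
    exact (isOpen_discrete _).preimage (by fun_prop)
  have hdir : Directed (· ⊇ ·) U :=
    (antitone_nat_of_succ_le fun N q hq n h₁ h₂ => hq n (by push_cast; omega)
      (by push_cast; omega)).directed_ge
  obtain ⟨N, hN⟩ := exists_subset_nhds_of_isCompact' hdir (fun N => (hU N).isCompact) hU
    (U := V) (by
      intro q hq
      refine hV.mem_nhds ?_
      have : q.1 = q.2 := Subtype.ext <| funext fun n =>
        Set.mem_iInter.1 hq n.natAbs n (by omega) (by omega)
      simp [V, this])
  exact ⟨N, fun x y h => hN (show (x, y) ∈ U N from h)⟩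

variable {B : Type*} {α : Substitution B} {θ : η.space → α.space}

theorem apply_translate_of_shift (hθ : ∀ x, θ (η.shiftMap x) = α.shiftMap (θ x)) (k : ℤ)
    (x : η.space) : θ (translate k x) = translate k (θ x) := by
  have nat : ∀ (n : ℕ) (x : η.space), θ (translate n x) = translate n (θ x) := by
    intro n
    induction n with
    | zero =>
      intro x
      have h₁ : translate ((0 : ℕ) : ℤ) x = x := Subtype.ext (by simp [translate])
      have h₂ : translate ((0 : ℕ) : ℤ) (θ x) = θ x := Subtype.ext (by simp [translate])
      rw [h₁, h₂]
    | succ n ih =>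
      intro x
      have h₁ : translate ((n + 1 : ℕ) : ℤ) x = η.shiftMap (translate n x) := by
        refine Subtype.ext (funext fun j => ?_)
        simp only [translate, shiftMap, shift, Nat.cast_succ]
        rw [add_right_comm, add_assoc]
      have h₂ : translate ((n + 1 : ℕ) : ℤ) (θ x) = α.shiftMap (translate n (θ x)) := by
        refine Subtype.ext (funext fun j => ?_)
        simp only [translate, shiftMap, shift, Nat.cast_succ]
        rw [add_right_comm, add_assoc]
      rw [h₁, h₂, hθ, ih]
  obtain ⟨n, rfl | rfl⟩ := k.eq_nat_or_neg
  · exact nat n x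
  · have h := nat n (translate (-n) x)
    have e : translate (n : ℤ) (translate (-(n : ℤ)) x) = x :=
      Subtype.ext (funext fun j => by simp [translate])
    rw [e] at h
    rw [h]
    exact Subtype.ext (funext fun j => by simp [translate])

theorem exists_sliding_window [Finite A] [TopologicalSpace A] [DiscreteTopology A]
    [TopologicalSpace B] [DiscreteTopology B] (hc : Continuous θ)
    (hθ : ∀ x, θ (η.shiftMap x) = α.shiftMap (θ x)) :
    ∃ N : ℤ, ∀ (x y : η.space) (k : ℤ), (∀ n, k - N ≤ n → n ≤ k + N → x.1 n = y.1 n) →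
      (θ x).1 k = (θ y).1 k := by
  obtain ⟨N, hN⟩ := exists_window (f := fun x => (θ x).1 0)
    ((continuous_apply 0).comp (continuous_subtype_val.comp hc))
  refine ⟨N, fun x y k h => ?_⟩
  have := hN (translate k x) (translate k y) fun n h₁ h₂ =>
    h (n + k) (by omega) (by omega)
  simpa [apply_translate_of_shift hθ, translate_apply] using this

end Sequences

/-! ### Points generated by cyclic pairs -/

section Generated

variable {A : Type*} {η : Substitution A}

theorem IsGeneratedBy.eq_getElem {b a : A} {x : ℤ → A} (hx : η.IsGeneratedBy b a x) :
    ∃ m, 0 < m ∧ ∀ k,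
      (∀ (j : ℕ) (h : j < (η.iter (m * k) [b]).length),
        x (-((η.iter (m * k) [b]).length : ℤ) + j) = (η.iter (m * k) [b])[j]) ∧
      ∀ (j : ℕ) (h : j < (η.iter (m * k) [a]).length), x j = (η.iter (m * k) [a])[j] := by
  obtain ⟨m, hm, h⟩ := hx
  refine ⟨m, hm.1, fun k => ?_⟩
  have e : η.iter (m * k) [b, a] = η.iter (m * k) [b] ++ η.iter (m * k) [a] :=
    η.iter_append _ [b] [a]
  have hk := h k
  rw [e, List.length_append, subword_add] at hk
  obtain ⟨h₁, h₂⟩ := List.append_inj hk (length_subword _ _ _)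
  refine ⟨fun j hj => ?_, fun j hj => ?_⟩
  · rw [← getElem_subword x _ (η.iter (m * k) [b]).length j (by rwa [length_subword])]
    simp only [h₁]
  · have := getElem_subword x (-((η.iter (m * k) [b]).length : ℤ) + (η.iter (m * k) [b]).length)
      (η.iter (m * k) [a]).length j (by rwa [length_subword])
    simp only [h₂] at this
    simp [this]

end Generated

theorem IsGeneratedBy.eq_of_neg {A : Type*} {η : Substitution A} [Nontrivial A]
    (hη : η.IsPrimitive) {a b d : A} {x y : ℤ → A} (hx : η.IsGeneratedBy b a x)
    (hy : η.IsGeneratedBy b d y) {n : ℤ} (hn : n < 0) : x n = y n := by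
  obtain ⟨l, hl, hx⟩ := hx.eq_getElem
  obtain ⟨m, hm, hy⟩ := hy.eq_getElem
  obtain ⟨k, hk⟩ := hη.exists_le_length_iter n.natAbs
  -- The two points may come with different periods `l`, `m`; a common multiple serves both.
  have h := hk (l * (m * k)) (by nlinarith [Nat.mul_pos hl hm]) b
  have h₁ := (hx (m * k)).1
  have h₂ := (hy (l * k)).1
  rw [show m * (l * k) = l * (m * k) by ring] at h₂
  obtain ⟨j, hj⟩ : ∃ j : ℕ, n = -((η.iter (l * (m * k)) [b]).length : ℤ) + j :=
    ⟨(n + (η.iter (l * (m * k)) [b]).length).toNat, by omega⟩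
  rw [hj, h₁ j (by omega), h₂ j (by omega)]

theorem IsGeneratedBy.eq_of_nonneg {A : Type*} {η : Substitution A} [Nontrivial A]
    (hη : η.IsPrimitive) {b c d : A} {x y : ℤ → A} (hx : η.IsGeneratedBy b d x)
    (hy : η.IsGeneratedBy c d y) {n : ℤ} (hn : 0 ≤ n) : x n = y n := by
  obtain ⟨l, hl, hx⟩ := hx.eq_getElem
  obtain ⟨m, hm, hy⟩ := hy.eq_getElem
  obtain ⟨k, hk⟩ := hη.exists_le_length_iter (n.natAbs + 1)
  have h := hk (l * (m * k)) (by nlinarith [Nat.mul_pos hl hm]) d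
  have h₁ := (hx (m * k)).2
  have h₂ := (hy (l * k)).2
  rw [show m * (l * k) = l * (m * k) by ring] at h₂
  obtain ⟨j, rfl⟩ := Int.eq_ofNat_of_zero_le hn
  rw [h₁ j (by omega), h₂ j (by omega)]

/-! ### Desubstitution in the Fibonacci language -/

section Fibonacci

@[simp] theorem fibonacci_onWord_nil : fibonacci.onWord [] = [] := rfl

@[simp] theorem fibonacci_onWord_zero (w : List (Fin 2)) :
    fibonacci.onWord (0 :: w) = 0 :: 1 :: fibonacci.onWord w := rfl

@[simp] theorem fibonacci_onWord_one (w : List (Fin 2)) :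
    fibonacci.onWord (1 :: w) = 0 :: fibonacci.onWord w := rfl

theorem fin_two_eq (a : Fin 2) : a = 0 ∨ a = 1 := by omega

theorem fibonacci_onWord_ne_one_cons (v w : List (Fin 2)) : fibonacci.onWord v ≠ 1 :: w := by
  rcases v with _ | ⟨a, v⟩
  · simp
  · obtain rfl | rfl := fin_two_eq a <;> simp

theorem fibonacci_onWord_injective : Function.Injective fibonacci.onWord := by
  intro v
  induction v with
  | nil =>
    intro w h
    rcases w with _ | ⟨a, w⟩
    · rfl
    · obtain rfl | rfl := fin_two_eq a <;> simp at h
  | cons a v ih =>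
    intro w h
    rcases w with _ | ⟨b, w⟩
    · obtain rfl | rfl := fin_two_eq a <;> simp at h
    · obtain rfl | rfl := fin_two_eq a <;> obtain rfl | rfl := fin_two_eq b
      · simp at h; rw [ih h]
      · simp at h; exact absurd h.symm (fibonacci_onWord_ne_one_cons _ _)
      · simp at h; exact absurd h (fibonacci_onWord_ne_one_cons _ _)
      · simp at h; rw [ih h]

/-- Each letter image has a single 0, at its start, so every 0 marks a cutting point. -/
theorem fibonacci_onWord_split (v : List (Fin 2)) : ∀ s t : List (Fin 2),
    fibonacci.onWord v = s ++ 0 :: t →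
      ∃ v₁ v₂, v = v₁ ++ v₂ ∧ fibonacci.onWord v₁ = s ∧ fibonacci.onWord v₂ = 0 :: t := by
  induction v with
  | nil => simp
  | cons a v ih =>
    intro s t h
    obtain rfl | rfl := fin_two_eq a
    · match s, h with
      | [], h => exact ⟨[], 0 :: v, rfl, rfl, h⟩
      | [_], h => simp at h
      | b :: c :: s, h =>
        simp only [fibonacci_onWord_zero, List.cons_append, List.cons.injEq] at h
        obtain ⟨rfl, rfl, h⟩ := h
        obtain ⟨v₁, v₂, rfl, rfl, h₂⟩ := ih s t h
        exact ⟨0 :: v₁, v₂, rfl, rfl, h₂⟩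
    · match s, h with
      | [], h => exact ⟨[], 1 :: v, rfl, rfl, h⟩
      | b :: s, h =>
        simp only [fibonacci_onWord_one, List.cons_append, List.cons.injEq] at h
        obtain ⟨rfl, h⟩ := h
        obtain ⟨v₁, v₂, rfl, rfl, h₂⟩ := ih s t h
        exact ⟨1 :: v₁, v₂, rfl, rfl, h₂⟩

theorem length_fibonacci_onWord_le (w : List (Fin 2)) :
    (fibonacci.onWord w).length ≤ 2 * w.length := by
  induction w with
  | nil => simp
  | cons a w ih =>
    obtain rfl | rfl := fin_two_eq a <;> simp <;> omega

theorem not_one_one_infix_fibonacci_onWord (v : List (Fin 2)) :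
    ¬ [1, 1] <:+: fibonacci.onWord v := by
  induction v with
  | nil => simp
  | cons a v ih =>
    obtain rfl | rfl := fin_two_eq a
    · simp only [fibonacci_onWord_zero, List.infix_cons_iff, List.cons_prefix_cons]
      rintro (⟨h, -⟩ | ⟨-, h⟩ | h)
      · simp at h
      · obtain ⟨t, h⟩ := h
        exact fibonacci_onWord_ne_one_cons v _ h.symm
      · exact ih h
    · simp only [fibonacci_onWord_one, List.infix_cons_iff, List.cons_prefix_cons]
      rintro (⟨h, -⟩ | h)
      · simp at h
      · exact ih h

theorem exists_infix_fibonacci_onWord {w : List (Fin 2)} (hw : w ∈ fibonacci.language) :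
    ∃ v ∈ fibonacci.language, w <:+: fibonacci.onWord v := by
  obtain ⟨n, a, h⟩ := hw
  cases n with
  | zero =>
    refine ⟨[0], ⟨0, 0, List.infix_rfl⟩, h.trans ?_⟩
    obtain rfl | rfl := fin_two_eq a
    · exact ⟨[], [1], rfl⟩
    · exact ⟨[0], [], rfl⟩
  | succ n => exact ⟨_, ⟨n, a, List.infix_rfl⟩, by rwa [← iter_succ]⟩

theorem one_one_notMem : [1, 1] ∉ fibonacci.language := by
  intro h
  obtain ⟨v, -, hv⟩ := exists_infix_fibonacci_onWord h
  exact not_one_one_infix_fibonacci_onWord v hv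

/-- The extra 0 certifies that `w` ends at a cutting point: a final 0 could otherwise be half of 01.
-/
theorem exists_fibonacci_onWord_eq {w : List (Fin 2)} (hw : w ++ [0] ∈ fibonacci.language)
    (h₀ : w.head? ≠ some 1) : ∃ v ∈ fibonacci.language, fibonacci.onWord v = w := by
  obtain ⟨u, hu, s, t, h⟩ := exists_infix_fibonacci_onWord hw
  rcases w with _ | ⟨a, w⟩
  · exact ⟨[], language_of_infix hu List.nil_infix, rfl⟩
  · obtain rfl : a = 0 := (fin_two_eq a).resolve_right (by simpa using h₀)
    obtain ⟨v₁, v₂, rfl, -, h₂⟩ := fibonacci_onWord_split u s (w ++ 0 :: t) (by simp [← h])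
    obtain ⟨v₃, v₄, rfl, h₃, -⟩ := fibonacci_onWord_split v₂ (0 :: w) t (by simp [h₂])
    exact ⟨v₃, language_of_infix hu ⟨v₁, v₄, by simp⟩, h₃⟩

theorem mem_language_of_fibonacci_onWord {w : List (Fin 2)}
    (hw : fibonacci.onWord w ++ [0] ∈ fibonacci.language) : w ∈ fibonacci.language := by
  obtain ⟨v, hv, h⟩ := exists_fibonacci_onWord_eq hw fun h => by
    obtain ⟨t, ht⟩ := List.head?_eq_some_iff.1 h
    exact fibonacci_onWord_ne_one_cons _ _ ht
  rwa [← fibonacci_onWord_injective h]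

theorem zero_zero_zero_notMem : [0, 0, 0] ∉ fibonacci.language := fun h =>
  one_one_notMem (mem_language_of_fibonacci_onWord (w := [1, 1]) h)

theorem exists_append_mem_fibonacci_language {w : List (Fin 2)} (hw : w ∈ fibonacci.language) :
    ∃ c, w ++ [c] ∈ fibonacci.language := by
  obtain ⟨n, a, s, t, h⟩ := hw
  have ha : [a, 0] ∈ fibonacci.language := by
    obtain rfl | rfl := fin_two_eq a
    · exact ⟨3, 0, [0, 1], [1], rfl⟩
    · exact ⟨2, 0, [0], [], rfl⟩
  have hm := iter_mem_language ha n
  rw [show [a, 0] = [a] ++ [0] from rfl, iter_append, ← h] at hm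
  have h₀ : 1 ≤ (fibonacci.iter n [0]).length :=
    fibonacci.length_iter_mono [0] (Nat.zero_le n)
  rcases e : t ++ fibonacci.iter n [0] with _ | ⟨c, t'⟩
  · simp only [List.append_eq_nil_iff] at e
    simp [e.2] at h₀
  · refine ⟨c, language_of_infix hm ⟨s, t', ?_⟩⟩
    rw [List.append_assoc, List.append_assoc, List.append_assoc, List.append_assoc, e]
    simp

theorem append_one_zero_mem {w : List (Fin 2)} (hw : w ++ [1] ∈ fibonacci.language) :
    w ++ [1, 0] ∈ fibonacci.language := by
  obtain ⟨c, hc⟩ := exists_append_mem_fibonacci_language hw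
  obtain rfl | rfl := fin_two_eq c
  · simpa using hc
  · exact absurd (language_of_infix hc ⟨w, [], by simp⟩) one_one_notMem

/-- The substitution and its mirror image are conjugate by the letter 0; this gives closure under
reversal. -/
theorem fibonacci_onWord_append_zero (w : List (Fin 2)) :
    fibonacci.onWord w ++ [0] = 0 :: (fibonacci.onWord w.reverse).reverse := by
  induction w with
  | nil => rfl
  | cons a w ih =>
    obtain rfl | rfl := fin_two_eq a <;> simp [onWord_append, ih]

theorem reverse_mem_fibonacci_language {w : List (Fin 2)} (hw : w ∈ fibonacci.language) :
    w.reverse ∈ fibonacci.language := by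
  have key : ∀ n a, (fibonacci.iter n [a]).reverse ∈ fibonacci.language := by
    intro n a
    induction n with
    | zero => exact ⟨0, a, List.infix_rfl⟩
    | succ n ih =>
      obtain ⟨c, hc⟩ := exists_append_mem_fibonacci_language ih
      have h := onWord_mem_language hc
      have h₁ := fibonacci_onWord_append_zero (fibonacci.iter n [a]).reverse
      rw [List.reverse_reverse, ← iter_succ] at h₁
      have h₂ : fibonacci.onWord (fibonacci.iter n [a]).reverse ++ [0] ∈ fibonacci.language := by
        refine language_of_infix h ?_
        rw [onWord_append]
        obtain rfl | rfl := fin_two_eq c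
        · exact ⟨[], [1], by simp⟩
        · exact ⟨[], [], by simp⟩
      rw [h₁] at h₂
      exact language_of_infix h₂ ⟨[0], [], by simp⟩
  obtain ⟨n, a, h⟩ := hw
  exact language_of_infix (key n a) (List.reverse_infix.2 h)

/-! ### Continuations of 01 and 10 after a common past -/

theorem exists_eq_onWord_append_zero {p : List (Fin 2)} (hp : p ++ [1] ∈ fibonacci.language)
    (hne : p ≠ []) :
    ∃ c q, p = c ++ fibonacci.onWord q ++ [0] ∧ p.length ≤ 2 * q.length + 2 := by
  obtain ⟨p, z, rfl⟩ := List.eq_nil_or_concat p |>.resolve_left hne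
  simp only [List.concat_eq_append] at hp ⊢
  obtain rfl : z = 0 := (fin_two_eq z).resolve_right fun h =>
    one_one_notMem (language_of_infix hp ⟨p, [], by simp [h]⟩)
  -- `c` is a possible leading 1, the second half of a cut image 01.
  obtain ⟨c, p', rfl, hc, hh⟩ :
      ∃ c p', p = c ++ p' ∧ c.length ≤ 1 ∧ p'.head? ≠ some (1 : Fin 2) := by
    rcases p with _ | ⟨a, p⟩
    · exact ⟨[], [], rfl, by simp, by simp⟩
    · obtain rfl | rfl := fin_two_eq a
      · exact ⟨[], 0 :: p, rfl, by simp, by simp⟩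
      · refine ⟨[1], p, rfl, by simp, fun h => ?_⟩
        obtain ⟨t, rfl⟩ := List.head?_eq_some_iff.1 h
        exact one_one_notMem (language_of_infix hp ⟨[], t ++ [0, 1], by simp⟩)
  obtain ⟨q, -, rfl⟩ := exists_fibonacci_onWord_eq
    (language_of_infix hp ⟨c, [1], by simp⟩ : p' ++ [0] ∈ _) hh
  refine ⟨c, q, rfl, ?_⟩
  have := length_fibonacci_onWord_le q
  simp only [List.length_append, List.length_singleton]
  omega

/-- Desubstitution exchanges 01 and 10 and shortens `r`, but about halves `p`. The bound on `p` is
chosen to survive `p.length ≤ 2 * q.length + 2` and to leave `q` nonempty in the base case. -/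
theorem eq_of_mem_fibonacci_language (n : ℕ) : ∀ (p r : List (Fin 2)) (a b : Fin 2),
    r.length ≤ n → 5 * 2 ^ n ≤ p.length + 2 →
    p ++ [0, 1] ++ r ++ [a] ∈ fibonacci.language →
    p ++ [1, 0] ++ r ++ [b] ∈ fibonacci.language → a = b := by
  induction n with
  | zero =>
    intro p r a b hr hp hu hv
    obtain rfl : r = [] := List.length_eq_zero_iff.1 (by omega)
    obtain rfl : a = 0 := (fin_two_eq a).resolve_right fun h =>
      one_one_notMem (language_of_infix hu ⟨p ++ [0], [], by simp [h]⟩)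
    refine ((fin_two_eq b).resolve_right ?_).symm
    rintro rfl
    obtain ⟨c, q, rfl, hq⟩ := exists_eq_onWord_append_zero (p := p)
      (language_of_infix hv ⟨[], [0, 1], by simp⟩) (by rintro rfl; simp at hp)
    have hu' : q ++ [1, 0] ∈ fibonacci.language := by
      refine mem_language_of_fibonacci_onWord (language_of_infix hu ⟨c, [], ?_⟩)
      simp [onWord_append]
    have hv' : q ++ [0, 0] ∈ fibonacci.language := by
      refine mem_language_of_fibonacci_onWord
        (language_of_infix (append_one_zero_mem hv) ⟨c, [], ?_⟩)
      simp [onWord_append]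
    -- Both `q10` and `q00` are in the language: a last letter 0 of `q` gives 000, a last letter 1
    -- gives 11.
    obtain ⟨q, z, rfl⟩ := List.eq_nil_or_concat q |>.resolve_left
      (by rintro rfl; simp at hp hq; omega)
    obtain rfl | rfl := fin_two_eq z
    · exact zero_zero_zero_notMem (language_of_infix hv' ⟨q, [], by simp⟩)
    · exact one_one_notMem (language_of_infix hu' ⟨q, [0], by simp⟩)
  | succ n ih =>
    intro p r a b hr hp hu hv
    rcases List.eq_nil_or_concat r with rfl | ⟨r, z, rfl⟩
    · refine ih p [] a b (by simp) ?_ hu hv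
      rw [pow_succ] at hp
      omega
    simp only [List.concat_eq_append, List.length_append, List.length_singleton] at hu hv hr
    by_contra hab
    obtain rfl : z = 0 := (fin_two_eq z).resolve_right fun h => by
      obtain rfl | rfl := fin_two_eq a
      · obtain rfl : b = 1 := by omega
        exact one_one_notMem (language_of_infix hv ⟨p ++ [1, 0] ++ r, [], by simp [h]⟩)
      · exact one_one_notMem (language_of_infix hu ⟨p ++ [0, 1] ++ r, [], by simp [h]⟩)
    obtain ⟨c, q, rfl, hq⟩ := exists_eq_onWord_append_zero (p := p)
      (language_of_infix hv ⟨[], [0] ++ r ++ [0, b], by simp⟩)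
      (by rintro rfl; have := Nat.one_le_two_pow (n := n + 1); simp at hp; omega)
    have hq' : 5 * 2 ^ n ≤ q.length + 2 := by rw [pow_succ] at hp; omega
    obtain ⟨r, -, rfl⟩ := exists_fibonacci_onWord_eq
      (language_of_infix hu ⟨c ++ fibonacci.onWord q ++ [0] ++ [0, 1], [a], by simp⟩ :
        r ++ [0] ∈ _) (by
          intro h
          obtain ⟨t, rfl⟩ := List.head?_eq_some_iff.1 h
          exact one_one_notMem (language_of_infix hu
            ⟨c ++ fibonacci.onWord q ++ [0, 0], t ++ [0, a], by simp⟩))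
    have hr' : r.length ≤ n := by
      have := fibonacci.length_le_length_onWord r
      omega
    -- With φ the substitution, 0·01·φ(r) = φ(10r) and 0·10·φ(r) = φ(01r). The ending 00 is φ(1)0,
    -- and 01 extends to φ(0)0, so the differing last letters are flipped and still differ.
    obtain rfl | rfl := fin_two_eq a
    · obtain rfl : b = 1 := by omega
      refine absurd (ih q r 0 1 hr' hq' ?_ ?_) (by decide)
      · refine mem_language_of_fibonacci_onWord
          (language_of_infix (append_one_zero_mem hv) ⟨c, [], ?_⟩)
        simp [onWord_append]
      · refine mem_language_of_fibonacci_onWord (language_of_infix hu ⟨c, [], ?_⟩)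
        simp [onWord_append]
    · obtain rfl : b = 0 := by omega
      refine absurd (ih q r 1 0 hr' hq' ?_ ?_) (by decide)
      · refine mem_language_of_fibonacci_onWord (language_of_infix hv ⟨c, [], ?_⟩)
        simp [onWord_append]
      · refine mem_language_of_fibonacci_onWord
          (language_of_infix (append_one_zero_mem hu) ⟨c, [], ?_⟩)
        simp [onWord_append]

/-! ### Asymptotic points of the Fibonacci system -/

theorem eq_zero_of_succ_eq_one {x : ℤ → Fin 2} (hx : x ∈ fibonacci.space) {i j : ℤ}
    (hj : j = i + 1) (h : x i = 1) : x j = 0 := by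
  subst hj
  refine (fin_two_eq _).resolve_right fun h' => one_one_notMem ?_
  have := hx i 2
  simpa [subword_eq_map, List.range_succ, h, h'] using this

theorem eq_one_of_zero_zero {x : ℤ → Fin 2} (hx : x ∈ fibonacci.space) {i : ℤ}
    (h : x i = 0) (h' : x (i + 1) = 0) : x (i + 2) = 1 := by
  refine (fin_two_eq _).resolve_left fun h'' => zero_zero_zero_notMem ?_
  have := hx i 3
  simpa [subword_eq_map, List.range_succ, h, h', h''] using this

theorem ne_iff_of_eq_of_neg {u v : ℤ → Fin 2} (hu : u ∈ fibonacci.space)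
    (hv : v ∈ fibonacci.space) (huv : ∀ n < 0, u n = v n) (hu₀ : u 0 = 0) (hv₀ : v 0 = 1)
    (n : ℤ) : u n ≠ v n ↔ n = 0 ∨ n = 1 := by
  have hv₁ : v 1 = 0 := eq_zero_of_succ_eq_one hv (by norm_num) hv₀
  have hv' : v (-1) = 0 := (fin_two_eq _).resolve_right fun h => by
    simp [eq_zero_of_succ_eq_one hv (show (0 : ℤ) = -1 + 1 by norm_num) h] at hv₀
  have hu₁ : u 1 = 1 := by
    simpa using eq_one_of_zero_zero hu (i := -1) (by rw [huv _ (by norm_num), hv'])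
      (by simpa using hu₀)
  -- The common past is infinite, so each `m` may use a prefix as long as the word lemma demands.
  have agree : ∀ m : ℕ, u (2 + m) = v (2 + m) := by
    intro m
    induction m using Nat.strong_induction_on with
    | _ m ih =>
      have split : ∀ x : ℤ → Fin 2, subword x (-(5 * 2 ^ m : ℕ)) (5 * 2 ^ m + 2 + m + 1) =
          subword x (-(5 * 2 ^ m : ℕ)) (5 * 2 ^ m) ++ [x 0, x 1] ++ subword x 2 m ++
            [x (2 + m)] := by
        intro x
        rw [subword_succ, subword_add, subword_add]
        have e₁ : (-(5 * 2 ^ m : ℕ) : ℤ) + (5 * 2 ^ m : ℕ) = 0 := by ring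
        have e₂ : (-(5 * 2 ^ m : ℕ) : ℤ) + (5 * 2 ^ m + 2 : ℕ) = 2 := by push_cast; ring
        have e₃ : (-(5 * 2 ^ m : ℕ) : ℤ) + (5 * 2 ^ m + 2 + m : ℕ) = 2 + m := by push_cast; ring
        rw [e₁, e₂, e₃]
        simp [subword_eq_map, List.range_succ]
      have h₁ := hu (-(5 * 2 ^ m : ℕ)) (5 * 2 ^ m + 2 + m + 1)
      have h₂ := hv (-(5 * 2 ^ m : ℕ)) (5 * 2 ^ m + 2 + m + 1)
      rw [split, hu₀, hu₁] at h₁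
      rw [split, hv₀, hv₁] at h₂
      rw [← subword_congr (x := u) (y := v) fun j _ hj => huv j (by omega),
        ← subword_congr (x := u) (y := v) (i := 2) fun j hj hj' => by
          obtain ⟨k, rfl⟩ : ∃ k : ℕ, j = 2 + k := ⟨(j - 2).toNat, by omega⟩
          exact ih k (by omega)] at h₂
      exact eq_of_mem_fibonacci_language m _ _ _ _ (by rw [length_subword])
        (by rw [length_subword]; omega) h₁ h₂
  constructor
  · intro h
    by_contra! hn
    rcases lt_or_ge n 0 with h' | h'
    · exact h (huv n h')
    · obtain ⟨k, rfl⟩ : ∃ k : ℕ, n = 2 + k := ⟨(n - 2).toNat, by omega⟩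
      exact h (agree k)
  · rintro (rfl | rfl)
    · simp [hu₀, hv₀]
    · simp [hu₁, hv₁]

theorem exists_ne_iff_of_left_asymptotic {u v : ℤ → Fin 2} (hu : u ∈ fibonacci.space)
    (hv : v ∈ fibonacci.space) (hne : u ≠ v) {M : ℤ} (huv : ∀ n < M, u n = v n) :
    ∃ k, ∀ n, u n ≠ v n ↔ n = k ∨ n = k + 1 := by
  obtain ⟨k, hk, hmin⟩ := Int.exists_least_of_bdd (P := fun n => u n ≠ v n)
    ⟨M, fun n h => not_lt.1 fun h' => h (huv n h')⟩ (Function.ne_iff.1 hne)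
  have hlt : ∀ n < 0, u (n + k) = v (n + k) := fun n hn => by
    by_contra h
    have := hmin _ h
    omega
  refine ⟨k, fun n => ?_⟩
  have e : n = k ∨ n = k + 1 ↔ n - k = 0 ∨ n - k = 1 := by omega
  rw [e]
  obtain h | h := fin_two_eq (u k)
  · have h' : v k = 1 := by omega
    simpa using ne_iff_of_eq_of_neg (translate_mem_space hu k) (translate_mem_space hv k) hlt
      (by simpa using h) (by simpa using h') (n - k)
  · have h' : v k = 0 := by omega
    simpa [ne_comm] using ne_iff_of_eq_of_neg (translate_mem_space hv k)
      (translate_mem_space hu k) (fun n hn => (hlt n hn).symm)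
      (by simpa using h') (by simpa using h) (n - k)

theorem reverse_mem_fibonacci_space {x : ℤ → Fin 2} (hx : x ∈ fibonacci.space) :
    (fun j => x (-j)) ∈ fibonacci.space := by
  intro i n
  rw [subword_reverse]
  exact reverse_mem_fibonacci_language (hx _ _)

theorem exists_ne_iff_of_right_asymptotic {u v : ℤ → Fin 2} (hu : u ∈ fibonacci.space)
    (hv : v ∈ fibonacci.space) (hne : u ≠ v) {M : ℤ} (huv : ∀ n > M, u n = v n) :
    ∃ k, ∀ n, u n ≠ v n ↔ n = k ∨ n = k + 1 := by
  obtain ⟨k, hk⟩ := exists_ne_iff_of_left_asymptotic (M := -M) (reverse_mem_fibonacci_space hu)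
    (reverse_mem_fibonacci_space hv)
    (fun h => hne (funext fun n => by simpa using congrFun h (-n)))
    (fun n hn => huv (-n) (by omega))
  refine ⟨-k - 1, fun n => ?_⟩
  have := hk (-n)
  rw [neg_neg] at this
  rw [this]
  omega

theorem eq_of_left_right_asymptotic {u v w : ℤ → Fin 2} (hu : u ∈ fibonacci.space)
    (hv : v ∈ fibonacci.space) (hw : w ∈ fibonacci.space) (huv : u ≠ v) (hvw : v ≠ w) {M : ℤ}
    (hl : ∀ n < M, u n = v n) {M' : ℤ} (hr : ∀ n > M', v n = w n) : u = w := by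
  by_contra hne
  obtain ⟨k, hk⟩ := exists_ne_iff_of_left_asymptotic hu hv huv hl
  obtain ⟨j, hj⟩ := exists_ne_iff_of_right_asymptotic hv hw hvw hr
  obtain ⟨l, h⟩ := exists_ne_iff_of_left_asymptotic (M := min k j) hu hw hne fun n hn => by
    have h₁ := hk n
    have h₂ := hj n
    omega
  -- Two letters only: `u n ≠ w n` exactly when one of `u n ≠ v n`, `v n ≠ w n` holds.
  have key : ∀ n, (n = l ∨ n = l + 1) ↔ ¬ ((n = k ∨ n = k + 1) ↔ (n = j ∨ n = j + 1)) := by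
    intro n
    rw [← hk, ← hj, ← h]
    omega
  have h₁ := key k
  have h₂ := key (k + 1)
  have h₃ := key j
  have h₄ := key (j + 1)
  have h₅ := key l
  omega

end Fibonacci

end Substitution

/-! ### Transfer to the Fibonacci system -/

theorem mainTheorem5 {A : Type*} [Finite A] [TopologicalSpace A] [DiscreteTopology A]
    (η : Substitution A) (hη : η.IsPrimitive)
    (hiso : Substitution.TopologicallyIsomorphic Substitution.fibonacci η) :
    ¬ ∃ x y z : η.space, η.IsZTriple x y z := by
  rintro ⟨x, y, z, hxy, hyz, hxz, a, b, c, d, hx, hy, hz⟩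
  obtain ⟨n, hn⟩ := Function.ne_iff.1 fun h => hxy (Subtype.ext h)
  have : Nontrivial A := ⟨_, _, hn⟩
  obtain ⟨ψ, hψ⟩ := hiso
  obtain ⟨N, hN⟩ := Substitution.exists_sliding_window (θ := ψ.symm) ψ.symm.continuous fun x => by
    rw [ψ.symm_apply_eq, hψ, ψ.apply_symm_apply]
  refine hxz (ψ.symm.injective (Subtype.ext ?_))
  refine Substitution.eq_of_left_right_asymptotic (M := -N) (M' := N) (ψ.symm x).2 (ψ.symm y).2
    (ψ.symm z).2 (fun h => hxy (ψ.symm.injective (Subtype.ext h)))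
    (fun h => hyz (ψ.symm.injective (Subtype.ext h))) (fun n hn => ?_) (fun n hn => ?_)
  · exact hN x y n fun k _ _ => hx.eq_of_neg hη hy (by omega)
  · exact hN y z n fun k _ _ => hy.eq_of_nonneg hη hz (by omega)
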